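/- Let $n\ge 1$ be an integer, $\lambda>0$, and let $\xi$ be an $n$-dimensional random vector with $\xi\sim N(\nu,\lambda^2 I_n)$, where $\nu\in\mathbb R^n$ has the form $\nu=(\|\nu\|,0,\dots,0)^{\mathsf T}$ and $\|\cdot\|$ is the Euclidean norm. Then the covariance matrix of the projected vector $\xi/\|\xi\|$ is diagonal and given by $$ \operatorname{cov}\!\left(\frac{\xi}{\|\xi\|}\right)=\begin{pmatrix} f_n\!\left(\frac{\|\nu\|}{\lambda}\right) & 0\\ 0 & g_n\!\left(\frac{\|\nu\|}{\lambda}\right) I_{n-1}\end{pmatrix}, $$ where $$ f_n(x)=1-\frac{n-1}{n}\,M\!\left(1,\frac n2+1,-\frac{x^2}{2}\right)-\varrho_n(x)^2,\qquad g_n(x)=\frac1n\,M\!\left(1,\frac n2+1,-\frac{x^2}{2}\right), $$ $$ \varrho_n(x)=\frac{\Gamma\!\left(\frac{n+1}{2}\right)}{\sqrt2\,\Gamma\!\left(\frac{n+2}{2}\right)}\,x\,M\!\left(\frac12,\frac{n+2}{2},-\frac{x^2}{2}\right), $$ and $M$ is Kummer's confluent hypergeometric function of the first kind, $$ M(a,b,z)=\sum_{k=0}^{\infty}\frac{a^{(k)}z^k}{b^{(k)}\,k!},\qquad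 a^{(0)}=1,\quad a^{(k)}=a(a+1)\cdots(a+k-1). $$ (For $n=1$ the block $g_nI_{n-1}$ is empty.) -/

import Mathlib

open MeasureTheory ProbabilityTheory

noncomputable section

/-- Kummer's confluent hypergeometric function of the first kind,
`M(a, b, z) = ∑ₖ a⁽ᵏ⁾ zᵏ / (b⁽ᵏ⁾ k!)` with rising factorials `a⁽ᵏ⁾ = a (a + 1) ⋯ (a + k - 1)`.
The series converges for all real `a`, `z` when `b` is not a non-positive integer;
it is only used with `b > 0`. -/
def kummerM (a b z : ℝ) : ℝ :=
  ∑' k : ℕ, (ascPochhammer ℝ k).eval a * z ^ k / ((ascPochhammer ℝ k).eval b * (k.factorial : ℝ))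

/-- The mean resultant length function
`ϱₙ(x) = Γ((n+1)/2) / (√2 Γ((n+2)/2)) · x · M(1/2, (n+2)/2, -x²/2)`. -/
def meanResultantLength (n : ℕ) (x : ℝ) : ℝ :=
  Real.Gamma (((n : ℝ) + 1) / 2) / (√2 * Real.Gamma (((n : ℝ) + 2) / 2)) * x *
    kummerM (1 / 2) (((n : ℝ) + 2) / 2) (-(1 / 2) * x ^ 2)

/-- `fₙ(x) = 1 - (n-1)/n · M(1, n/2 + 1, -x²/2) - ϱₙ(x)²`. -/
def axialVariance (n : ℕ) (x : ℝ) : ℝ :=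
  1 - ((n : ℝ) - 1) / n * kummerM 1 ((n : ℝ) / 2 + 1) (-(x ^ 2 / 2)) -
    meanResultantLength n x ^ 2

/-- `gₙ(x) = 1/n · M(1, n/2 + 1, -x²/2)`. -/
def transverseVariance (n : ℕ) (x : ℝ) : ℝ :=
  1 / (n : ℝ) * kummerM 1 ((n : ℝ) / 2 + 1) (-(x ^ 2 / 2))

/-- The covariance matrix of a random vector `X`, with entries `cov(Xᵢ, Xⱼ)`. -/
def covarianceMatrix {Ω : Type*} [MeasurableSpace Ω] {n : ℕ}
    (X : Ω → EuclideanSpace ℝ (Fin n)) (P : Measure Ω) : Matrix (Fin n) (Fin n) ℝ :=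
  Matrix.of fun i j => covariance (fun ω => X ω i) (fun ω => X ω j) P

end

/-! Normalization is scale-invariant, so `ξ` may be replaced by a vector `y` with independent
coordinates `N(m k, 1)`, where `m = ν / lam`. The Gamma integral writes `|y|^(-2s)` as a
superposition of the weights `exp (-t|y|²)`. Such a weight factors over coordinates and turns each
`N(m k, 1)` into a constant multiple of `N(m k / (1 + 2t), 1 / (1 + 2t))`, so only elementary
Gaussian moments remain inside the `t`-integral.

The mean (`s = 1/2`) and the second moment of a centred coordinate (`s = 1`) then carry the same
factor `(1 + 2t)^(-n/2 - 1)`. The substitution `u = 2t / (1 + 2t)` makes both Euler integrals for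
Kummer's function with second parameter `n/2 + 1`. The axial second moment follows because the
squared coordinates of a unit vector sum to 1; mixed moments vanish because at most one coordinate
has nonzero mean. -/

/-! ### Beta integrals and Kummer's function -/

theorem ascPochhammer_eval_mul_Gamma {a : ℝ} (ha : 0 < a) (k : ℕ) :
    (ascPochhammer ℝ k).eval a * Real.Gamma a = Real.Gamma (a + k) := by
  induction k with
  | zero => simp
  | succ k ih =>
    rw [ascPochhammer_succ_eval, mul_right_comm, ih, Nat.cast_succ, ← add_assoc,
      Real.Gamma_add_one (by positivity)]
    ring

theorem integrableOn_rpow_mul_one_sub_rpow {a b : ℝ} (ha : 0 < a) (hb : 0 < b) :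
    IntegrableOn (fun u : ℝ => u ^ (a - 1) * (1 - u) ^ (b - 1)) (Set.Ioo 0 1) := by
  have h := Complex.betaIntegral_convergent (u := a) (v := b) (by simpa) (by simpa)
  rw [intervalIntegrable_iff_integrableOn_Ioo_of_le zero_le_one] at h
  refine h.re.congr ?_
  refine (ae_restrict_iff' measurableSet_Ioo).2 (ae_of_all _ fun u hu => ?_)
  have h0 := hu.1.le
  have h1 : 0 ≤ 1 - u := by linarith [hu.2]
  norm_cast
  simp only
  rw [← Complex.ofReal_cpow h0, ← Complex.ofReal_cpow h1]
  norm_cast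

theorem setIntegral_rpow_mul_one_sub_rpow {a b : ℝ} (ha : 0 < a) (hb : 0 < b) :
    ∫ u in Set.Ioo (0 : ℝ) 1, u ^ (a - 1) * (1 - u) ^ (b - 1) =
      Real.Gamma a * Real.Gamma b / Real.Gamma (a + b) := by
  have h := beta_eq_betaIntegralReal a b ha hb
  rw [beta] at h
  rw [h, Complex.betaIntegral, intervalIntegral.integral_of_le zero_le_one,
    ← integral_Ioc_eq_integral_Ioo, ← RCLike.re_to_complex, ← integral_re]
  · refine setIntegral_congr_fun measurableSet_Ioc fun u hu => ?_
    have h0 := hu.1.le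
    have h1 : 0 ≤ 1 - u := by linarith [hu.2]
    norm_cast
    rw [← Complex.ofReal_cpow h0, ← Complex.ofReal_cpow h1]
    norm_cast
  · have := Complex.betaIntegral_convergent (u := a) (v := b) (by simpa) (by simpa)
    rwa [intervalIntegrable_iff_integrableOn_Ioc_of_le zero_le_one] at this

/-- Euler's integral representation of Kummer's function. -/
theorem setIntegral_rpow_mul_one_sub_rpow_mul_exp {a b : ℝ} (ha : 0 < a) (hb : 0 < b) (z : ℝ) :
    ∫ u in Set.Ioo (0 : ℝ) 1, u ^ (a - 1) * (1 - u) ^ (b - 1) * Real.exp (z * u) =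
      Real.Gamma a * Real.Gamma b / Real.Gamma (a + b) * kummerM a (a + b) z := by
  have hG := integrableOn_rpow_mul_one_sub_rpow ha hb
  set w : ℝ → ℝ := fun u => u ^ (a - 1) * (1 - u) ^ (b - 1) with hw
  have hw0 : ∀ u ∈ Set.Ioo (0 : ℝ) 1, 0 ≤ w u := fun u hu =>
    mul_nonneg (Real.rpow_nonneg hu.1.le _) (Real.rpow_nonneg (by linarith [hu.2]) _)
  -- Expand the exponential: `u ^ k` shifts the Beta parameter `a` to `a + k`, and the Gamma ratios
  -- become rising factorials.
  have hterm : ∀ k : ℕ, ∫ u in Set.Ioo (0 : ℝ) 1, w u * ((z * u) ^ k / k.factorial) =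
      Real.Gamma a * Real.Gamma b / Real.Gamma (a + b) *
        ((ascPochhammer ℝ k).eval a * z ^ k /
          ((ascPochhammer ℝ k).eval (a + b) * (k.factorial : ℝ))) := by
    intro k
    have h1 : ∫ u in Set.Ioo (0 : ℝ) 1, w u * ((z * u) ^ k / k.factorial) =
        ∫ u in Set.Ioo (0 : ℝ) 1, z ^ k / k.factorial *
          (u ^ ((a + k) - 1) * (1 - u) ^ (b - 1)) := by
      refine setIntegral_congr_fun measurableSet_Ioo fun u hu => ?_
      have : u ^ ((a + k) - 1) = u ^ (a - 1) * u ^ k := by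
        rw [← Real.rpow_add_natCast hu.1.ne']; ring_nf
      simp only [hw, this, mul_pow]
      ring
    rw [h1, integral_const_mul, setIntegral_rpow_mul_one_sub_rpow (by positivity) hb,
      ← ascPochhammer_eval_mul_Gamma ha, show a + k + b = a + b + k by ring,
      ← ascPochhammer_eval_mul_Gamma (add_pos ha hb)]
    have := (Real.Gamma_pos_of_pos (add_pos ha hb)).ne'
    have := (ascPochhammer_pos k (a + b) (add_pos ha hb)).ne'
    field_simp
  -- Since `u < 1`, the terms are dominated by those of the series of `exp |z|` times `w`, which
  -- justifies termwise integration.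
  have hbound : ∀ k : ℕ, ∀ u ∈ Set.Ioo (0 : ℝ) 1,
      ‖w u * ((z * u) ^ k / k.factorial)‖ ≤ |z| ^ k / k.factorial * w u := by
    intro k u hu
    rw [norm_mul, Real.norm_of_nonneg (hw0 u hu), mul_comm, norm_div, norm_pow, norm_mul,
      Real.norm_natCast, Real.norm_of_nonneg hu.1.le, Real.norm_eq_abs]
    have := hw0 u hu
    have : |z| * u ≤ |z| := mul_le_of_le_one_right (abs_nonneg z) hu.2.le
    have := hu.1.le
    gcongr
  have hint : ∀ k : ℕ, Integrable (fun u => w u * ((z * u) ^ k / k.factorial))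
      (volume.restrict (Set.Ioo 0 1)) := by
    intro k
    refine (hG.const_mul (|z| ^ k / k.factorial)).mono' (by fun_prop) ?_
    exact (ae_restrict_iff' measurableSet_Ioo).2 (ae_of_all _ (hbound k))
  have hsum : Summable fun k : ℕ =>
      ∫ u in Set.Ioo (0 : ℝ) 1, ‖w u * ((z * u) ^ k / k.factorial)‖ := by
    refine Summable.of_nonneg_of_le (fun k => by positivity) (fun k => ?_)
      ((Real.summable_pow_div_factorial |z|).mul_right (∫ u in Set.Ioo (0 : ℝ) 1, w u))
    rw [← integral_const_mul]
    exact setIntegral_mono_on (hint k).norm (hG.const_mul _) measurableSet_Ioo (hbound k)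
  rw [kummerM, ← tsum_mul_left]
  simp_rw [← hterm]
  rw [integral_tsum_of_summable_integral_norm hint hsum]
  refine integral_congr_ae (ae_of_all _ fun u => ?_)
  simp only [tsum_mul_left]
  rw [Real.exp_eq_exp_ℝ, NormedSpace.exp_eq_tsum_div]

/-- The substitution `t = u / (2(1 - u))` is chosen so that `1 + 2t = 1 / (1 - u)` and `t / (1 + 2t)
= u / 2`. -/
theorem setIntegral_Ioi_eq_setIntegral_Ioo (h : ℝ → ℝ) :
    ∫ t in Set.Ioi (0 : ℝ), h t =
      ∫ u in Set.Ioo (0 : ℝ) 1, (2 * (1 - u) ^ 2)⁻¹ * h (u / (2 * (1 - u))) := by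
  have himg : (fun u : ℝ => u / (2 * (1 - u))) '' Set.Ioo 0 1 = Set.Ioi 0 := by
    ext t
    simp only [Set.mem_image, Set.mem_Ioo, Set.mem_Ioi]
    constructor
    · rintro ⟨u, ⟨h0, h1⟩, rfl⟩
      have : 0 < 1 - u := by linarith
      positivity
    · intro ht
      have h2 : 0 < 1 + 2 * t := by positivity
      refine ⟨2 * t / (1 + 2 * t), ⟨by positivity, (div_lt_one h2).2 (by linarith)⟩, ?_⟩
      have : 1 - 2 * t / (1 + 2 * t) = 1 / (1 + 2 * t) := by field_simp; ring
      rw [this]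
      field_simp
  have hderiv : ∀ u ∈ Set.Ioo (0 : ℝ) 1, HasDerivWithinAt (fun u : ℝ => u / (2 * (1 - u)))
      (2 * (1 - u) ^ 2)⁻¹ (Set.Ioo 0 1) u := by
    intro u hu
    have h1 : 1 - u ≠ 0 := by linarith [hu.2]
    have h2 := (hasDerivAt_id u).fun_div (((hasDerivAt_id u).const_sub 1).const_mul 2)
      (mul_ne_zero two_ne_zero h1)
    refine (h2.congr_deriv ?_).hasDerivWithinAt
    simp only [id]
    field_simp
    ring
  have hinj : Set.InjOn (fun u : ℝ => u / (2 * (1 - u))) (Set.Ioo 0 1) := by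
    intro u hu v hv huv
    have h1 : 1 - u ≠ 0 := by linarith [hu.2]
    have h2 : 1 - v ≠ 0 := by linarith [hv.2]
    simp only at huv
    field_simp at huv
    linarith
  rw [← himg, integral_image_eq_integral_abs_deriv_smul measurableSet_Ioo hderiv hinj]
  refine setIntegral_congr_fun measurableSet_Ioo fun u hu => ?_
  rw [smul_eq_mul, abs_of_nonneg (by positivity)]

/-! ### Gamma integral and Gaussian tilting -/

/-- Fubini applied to `R ^ (-s) Γ(s) = ∫ t ^ (s - 1) exp (-tR) dt`. The kernel is nonnegative, so
integrability of `F * R ^ (-s)` already gives joint integrability. -/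
theorem integral_mul_rpow_neg_eq {α : Type*} [MeasurableSpace α] {μ : Measure α} [SFinite μ]
    {F R : α → ℝ} (hF : Measurable F) (hR : Measurable R) (hpos : ∀ᵐ y ∂μ, 0 < R y)
    {s : ℝ} (hs : 0 < s) (hint : Integrable (fun y => F y * R y ^ (-s)) μ) :
    ∫ y, F y * R y ^ (-s) ∂μ = (Real.Gamma s)⁻¹ *
      ∫ t in Set.Ioi (0 : ℝ), t ^ (s - 1) * ∫ y, F y * Real.exp (-(t * R y)) ∂μ := by
  have hΓ := Real.Gamma_pos_of_pos hs
  have hone : ∀ r : ℝ, 0 < r → ∫ t in Set.Ioi (0 : ℝ), t ^ (s - 1) * Real.exp (-(t * r)) =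
      r ^ (-s) * Real.Gamma s := by
    intro r hr
    have := Real.integral_rpow_mul_exp_neg_mul_Ioi hs hr
    simp_rw [mul_comm r] at this
    rw [this, one_div, Real.inv_rpow hr.le, Real.rpow_neg hr.le]
  have hi1 : ∀ r : ℝ, 0 < r →
      IntegrableOn (fun t : ℝ => t ^ (s - 1) * Real.exp (-(t * r))) (Set.Ioi 0) := by
    intro r hr
    -- A non-integrable function would have integral 0 by convention, contradicting the positive
    -- value in `hone`.
    by_contra hcon
    have h1 := hone r hr
    rw [integral_undef hcon] at h1
    have := Real.rpow_pos_of_pos hr (-s)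
    have : 0 < r ^ (-s) * Real.Gamma s := by positivity
    linarith
  have hmeas : AEStronglyMeasurable
      (Function.uncurry fun (y : α) (t : ℝ) => F y * (t ^ (s - 1) * Real.exp (-(t * R y))))
      (μ.prod (volume.restrict (Set.Ioi 0))) := by
    apply Measurable.aestronglyMeasurable
    simp only [Function.uncurry_def]
    fun_prop
  have hprod : Integrable
      (Function.uncurry fun (y : α) (t : ℝ) => F y * (t ^ (s - 1) * Real.exp (-(t * R y))))
      (μ.prod (volume.restrict (Set.Ioi 0))) := by
    rw [integrable_prod_iff hmeas]
    constructor
    · filter_upwards [hpos] with y hy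
      exact (hi1 _ hy).const_mul (F y)
    · refine (hint.norm.mul_const (Real.Gamma s)).congr ?_
      filter_upwards [hpos] with y hy
      have : ∫ t in Set.Ioi (0 : ℝ), ‖F y * (t ^ (s - 1) * Real.exp (-(t * R y)))‖ =
          ∫ t in Set.Ioi (0 : ℝ), ‖F y‖ * (t ^ (s - 1) * Real.exp (-(t * R y))) := by
        refine setIntegral_congr_fun measurableSet_Ioi fun t ht => ?_
        have : 0 ≤ t ^ (s - 1) := Real.rpow_nonneg (le_of_lt ht) _
        simp only [norm_mul, Real.norm_of_nonneg this, Real.norm_of_nonneg (Real.exp_pos _).le]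
      simp only [Function.uncurry]
      rw [this, integral_const_mul, hone _ hy, norm_mul,
        Real.norm_of_nonneg (Real.rpow_pos_of_pos hy _).le, mul_assoc]
  have hswap := integral_integral_swap hprod
  have hl : ∫ y, (∫ t in Set.Ioi (0 : ℝ), F y * (t ^ (s - 1) * Real.exp (-(t * R y)))) ∂μ =
      (∫ y, F y * R y ^ (-s) ∂μ) * Real.Gamma s := by
    rw [← integral_mul_const]
    refine integral_congr_ae ?_
    filter_upwards [hpos] with y hy
    rw [integral_const_mul, hone _ hy, mul_assoc]
  rw [hl] at hswap
  rw [eq_inv_mul_iff_mul_eq₀ hΓ.ne', mul_comm, hswap]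
  refine integral_congr_ae (ae_of_all _ fun t => ?_)
  simp only
  rw [← integral_const_mul]
  refine integral_congr_ae (ae_of_all _ fun y => ?_)
  simp only
  ring

/-- Completing the square in the exponent. The integrands with respect to Lebesgue measure agree
pointwise, so `φ` may be arbitrary. -/
theorem integral_mul_exp_neg_mul_sq_gaussianReal (φ : ℝ → ℝ) (m : ℝ) {t : ℝ} (ht : 0 < t) :
    ∫ y, φ y * Real.exp (-(t * y ^ 2)) ∂(gaussianReal m 1) =
      (√(1 + 2 * t))⁻¹ * Real.exp (-(t * m ^ 2 / (1 + 2 * t))) *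
        ∫ y, φ y ∂(gaussianReal (m / (1 + 2 * t)) (Real.toNNReal (1 + 2 * t)⁻¹)) := by
  have h2 : 0 < 1 + 2 * t := by positivity
  have hv : Real.toNNReal (1 + 2 * t)⁻¹ ≠ 0 := by
    simpa using h2
  rw [integral_gaussianReal_eq_integral_smul one_ne_zero,
    integral_gaussianReal_eq_integral_smul hv, ← integral_const_mul]
  refine integral_congr_ae (ae_of_all _ fun y => ?_)
  simp only [gaussianPDFReal, smul_eq_mul, Real.coe_toNNReal _ (inv_pos.2 h2).le, NNReal.coe_one,
    mul_one]
  have e1 : Real.exp (-(y - m) ^ 2 / 2) * Real.exp (-(t * y ^ 2)) =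
      Real.exp (-(t * m ^ 2 / (1 + 2 * t))) *
        Real.exp (-(y - m / (1 + 2 * t)) ^ 2 / (2 * (1 + 2 * t)⁻¹)) := by
    rw [← Real.exp_add, ← Real.exp_add]
    congr 1
    field_simp
    ring
  have e2 : (√(2 * Real.pi))⁻¹ = (√(1 + 2 * t))⁻¹ * (√(2 * Real.pi * (1 + 2 * t)⁻¹))⁻¹ := by
    rw [← mul_inv, ← Real.sqrt_mul h2.le]
    congr 2
    field_simp
  calc _ = (√(2 * Real.pi))⁻¹ * φ y *
        (Real.exp (-(y - m) ^ 2 / 2) * Real.exp (-(t * y ^ 2))) := by ring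
    _ = _ := by rw [e1, e2]; ring

theorem integral_prod_mul_exp_neg_mul_sum_sq_pi_gaussianReal {ι : Type*} [Fintype ι]
    (φ : ι → ℝ → ℝ) (m : ι → ℝ) {t : ℝ} (ht : 0 < t) :
    ∫ y, (∏ k, φ k (y k)) * Real.exp (-(t * ∑ k, y k ^ 2))
        ∂(Measure.pi fun k => gaussianReal (m k) 1) =
      (√(1 + 2 * t))⁻¹ ^ Fintype.card ι * Real.exp (-(t * (∑ k, m k ^ 2) / (1 + 2 * t))) *
        ∏ k, ∫ y, φ k y ∂(gaussianReal (m k / (1 + 2 * t)) (Real.toNNReal (1 + 2 * t)⁻¹)) := by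
  have h1 : ∀ y : ι → ℝ, (∏ k, φ k (y k)) * Real.exp (-(t * ∑ k, y k ^ 2)) =
      ∏ k, (φ k (y k) * Real.exp (-(t * y k ^ 2))) := by
    intro y
    rw [Finset.prod_mul_distrib, ← Real.exp_sum, Finset.sum_neg_distrib, Finset.mul_sum]
  simp_rw [h1]
  rw [integral_fintype_prod_eq_prod (f := fun k y => φ k y * Real.exp (-(t * y ^ 2)))]
  simp_rw [integral_mul_exp_neg_mul_sq_gaussianReal _ _ ht]
  rw [Finset.prod_mul_distrib, Finset.prod_mul_distrib, ← Real.exp_sum, Finset.prod_const,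
    Finset.card_univ, Finset.sum_neg_distrib, Finset.mul_sum, Finset.sum_div]

/-- Both measures have the same characteristic function. This passes from the isotropic Gaussian to
independent unit-variance coordinates. -/
theorem map_pi_gaussianReal_eq_multivariateGaussian {ι : Type*} [Fintype ι] [DecidableEq ι]
    (m : ι → ℝ) {c : ℝ} :
    (Measure.pi fun k => gaussianReal (m k) 1).map (fun y => c • WithLp.toLp 2 y) =
      multivariateGaussian (c • WithLp.toLp 2 m) (c ^ 2 • (1 : Matrix ι ι ℝ)) := by
  have hS : (c ^ 2 • (1 : Matrix ι ι ℝ)).PosSemidef := Matrix.PosSemidef.one.smul (by positivity)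
  have : (Measure.pi fun k => gaussianReal (m k) 1).map (fun y => c • WithLp.toLp 2 y) =
      ((Measure.pi fun k => gaussianReal (m k) 1).map (WithLp.toLp 2)).map
        (fun y : EuclideanSpace ℝ ι => c • y) := by
    rw [Measure.map_map (by fun_prop) (by fun_prop)]
    rfl
  rw [this]
  have := Measure.isProbabilityMeasure_map (μ := Measure.pi fun k => gaussianReal (m k) 1)
    (f := (WithLp.toLp 2 : (ι → ℝ) → EuclideanSpace ℝ ι)) (by fun_prop)
  have := Measure.isProbabilityMeasure_map
    (μ := (Measure.pi fun k => gaussianReal (m k) 1).map (WithLp.toLp 2 : (ι → ℝ) → EuclideanSpace ℝ ι))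
    (f := fun y : EuclideanSpace ℝ ι => c • y) (by fun_prop)
  apply Measure.ext_of_charFun (E := EuclideanSpace ℝ ι)
  ext x
  rw [charFun_multivariateGaussian hS, charFun_map_smul]
  simp_rw [charFun_pi, charFun_gaussianReal, ← Complex.exp_sum]
  congr 1
  simp [PiLp.inner_apply, Matrix.smul_mulVec, dotProduct, Finset.sum_sub_distrib, Finset.sum_mul,
    Finset.sum_div]
  congr 1 <;> refine Finset.sum_congr rfl fun k _ => by ring

/-- Euclidean norm squared of a coordinate vector is positive almost surely. -/
theorem ae_sum_sq_pos_pi_gaussianReal {ι : Type*} [Fintype ι] (m : ι → ℝ) (i : ι) :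
    ∀ᵐ y ∂(Measure.pi fun k => gaussianReal (m k) 1), 0 < ∑ k, y k ^ 2 := by
  have := nullSingletonClass_gaussianReal (μ := m i) one_ne_zero
  have h0 := Measure.pi_hyperplane (fun k => gaussianReal (m k) 1) i 0
  have h1 : ∀ᵐ y ∂(Measure.pi fun k => gaussianReal (m k) 1), y i ≠ 0 := by
    rw [ae_iff]; simpa using h0
  filter_upwards [h1] with y hy
  exact Finset.sum_pos' (fun k _ => sq_nonneg _) ⟨i, Finset.mem_univ i, by positivity⟩

theorem integral_eval_mul_exp_neg_mul_sum_sq_pi_gaussianReal {ι : Type*} [Fintype ι]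
    (m : ι → ℝ) {t : ℝ} (ht : 0 < t) (i : ι) :
    ∫ y, y i * Real.exp (-(t * ∑ k, y k ^ 2)) ∂(Measure.pi fun k => gaussianReal (m k) 1) =
      (√(1 + 2 * t))⁻¹ ^ Fintype.card ι * Real.exp (-(t * (∑ k, m k ^ 2) / (1 + 2 * t))) *
        (m i / (1 + 2 * t)) := by
  classical
  have h := integral_prod_mul_exp_neg_mul_sum_sq_pi_gaussianReal
    (fun k y => if k = i then y else 1) m ht
  have h2 : ∀ k, ∫ y, (if k = i then y else 1)
      ∂(gaussianReal (m k / (1 + 2 * t)) (Real.toNNReal (1 + 2 * t)⁻¹)) =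
      if k = i then m k / (1 + 2 * t) else 1 := by
    intro k
    split_ifs <;> simp
  simpa [h2] using h

theorem integral_eval_mul_eval_mul_exp_neg_mul_sum_sq_pi_gaussianReal {ι : Type*} [Fintype ι]
    (m : ι → ℝ) {t : ℝ} (ht : 0 < t) {i j : ι} (hij : i ≠ j) :
    ∫ y, y i * y j * Real.exp (-(t * ∑ k, y k ^ 2))
        ∂(Measure.pi fun k => gaussianReal (m k) 1) =
      (√(1 + 2 * t))⁻¹ ^ Fintype.card ι * Real.exp (-(t * (∑ k, m k ^ 2) / (1 + 2 * t))) *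
        (m i / (1 + 2 * t) * (m j / (1 + 2 * t))) := by
  classical
  have h := integral_prod_mul_exp_neg_mul_sum_sq_pi_gaussianReal
    (fun k y => (if k = i then y else 1) * (if k = j then y else 1)) m ht
  have h2 : ∀ k, ∫ y, (if k = i then y else 1) * (if k = j then y else 1)
      ∂(gaussianReal (m k / (1 + 2 * t)) (Real.toNNReal (1 + 2 * t)⁻¹)) =
      (if k = i then m k / (1 + 2 * t) else 1) * (if k = j then m k / (1 + 2 * t) else 1) := by
    intro k
    by_cases hi : k = i
    · simp [hi, hij]
    · by_cases hj : k = j <;> simp [hi, hj, hij.symm]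
  simp_rw [h2, Finset.prod_mul_distrib] at h
  simpa using h

theorem integral_sq_gaussianReal (m : ℝ) (v : NNReal) :
    ∫ y, y ^ 2 ∂(gaussianReal m v) = v + m ^ 2 := by
  have h := variance_eq_sub (memLp_id_gaussianReal (μ := m) (v := v) 2)
  simp only [variance_id_gaussianReal, Pi.pow_apply, id, integral_id_gaussianReal] at h
  linarith

theorem integral_eval_sq_mul_exp_neg_mul_sum_sq_pi_gaussianReal {ι : Type*} [Fintype ι]
    (m : ι → ℝ) {t : ℝ} (ht : 0 < t) (i : ι) :
    ∫ y, y i * y i * Real.exp (-(t * ∑ k, y k ^ 2))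
        ∂(Measure.pi fun k => gaussianReal (m k) 1) =
      (√(1 + 2 * t))⁻¹ ^ Fintype.card ι * Real.exp (-(t * (∑ k, m k ^ 2) / (1 + 2 * t))) *
        ((1 + 2 * t)⁻¹ + (m i / (1 + 2 * t)) ^ 2) := by
  classical
  have h := integral_prod_mul_exp_neg_mul_sum_sq_pi_gaussianReal
    (fun k y => if k = i then y ^ 2 else 1) m ht
  have h2 : ∀ k, ∫ y, (if k = i then y ^ 2 else 1)
      ∂(gaussianReal (m k / (1 + 2 * t)) (Real.toNNReal (1 + 2 * t)⁻¹)) =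
      if k = i then (1 + 2 * t)⁻¹ + (m k / (1 + 2 * t)) ^ 2 else 1 := by
    intro k
    have : 0 ≤ (1 + 2 * t)⁻¹ := by positivity
    split_ifs
    · rw [integral_sq_gaussianReal, Real.coe_toNNReal _ this]
    · simp
  simpa [h2, ← pow_two] using h

/-- The common Laplace-type integral. -/
theorem setIntegral_rpow_mul_inv_sqrt_pow_mul_exp (n : ℕ) (q : ℝ) {s : ℝ} (hs : 0 < s)
    (hs1 : s < n / 2 + 1) :
    ∫ t in Set.Ioi (0 : ℝ), t ^ (s - 1) *
        ((√(1 + 2 * t))⁻¹ ^ n * Real.exp (-(t * q / (1 + 2 * t))) * (1 + 2 * t)⁻¹) =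
      2 ^ (-s) * (Real.Gamma s * Real.Gamma (n / 2 + 1 - s) / Real.Gamma (n / 2 + 1) *
        kummerM s (n / 2 + 1) (-(q / 2))) := by
  -- The Euler integral is used with `a = s` and `b = n/2 + 1 - s`, so that `a + b = n/2 + 1`.
  have hE := setIntegral_rpow_mul_one_sub_rpow_mul_exp hs (sub_pos.2 hs1) (-(q / 2))
  rw [add_sub_cancel] at hE
  rw [setIntegral_Ioi_eq_setIntegral_Ioo, ← hE, ← integral_const_mul]
  refine setIntegral_congr_fun measurableSet_Ioo fun u hu => ?_
  obtain ⟨h0, hu1⟩ := hu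
  have h1 : 0 < 1 - u := by linarith
  have e0 : 1 + 2 * (u / (2 * (1 - u))) = (1 - u)⁻¹ := by field_simp; ring
  have e1 : (√((1 - u)⁻¹))⁻¹ ^ n = (1 - u) ^ ((n : ℝ) / 2) := by
    rw [Real.sqrt_inv, inv_inv, Real.sqrt_eq_rpow, ← Real.rpow_mul_natCast h1.le]
    ring_nf
  have e2 : (u / (2 * (1 - u))) ^ (s - 1) =
      u ^ (s - 1) * (2 ^ (-s) * 2) * (1 - u) ^ (1 - s) := by
    rw [Real.div_rpow h0.le (by positivity), Real.mul_rpow zero_le_two h1.le, div_eq_mul_inv,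
      mul_inv, ← Real.rpow_neg zero_le_two, ← Real.rpow_neg h1.le, neg_sub,
      ← Real.rpow_add_one two_ne_zero, mul_assoc]
    ring_nf
  have e3 : (1 - u) ^ ((n : ℝ) / 2 + 1 - s - 1) * (1 - u) =
      (1 - u) ^ ((n : ℝ) / 2) * (1 - u) ^ (1 - s) := by
    rw [← Real.rpow_add_one h1.ne', ← Real.rpow_add h1]
    ring_nf
  have e4 : -(u / (2 * (1 - u)) * q / (1 - u)⁻¹) = -(q / 2) * u := by field_simp
  -- The last factor is what remains of the Jacobian's `(1 - u)⁻²` after multiplication by `(1 +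
  -- 2t)⁻¹ = 1 - u`.
  have e5 : (1 - u) ^ ((n : ℝ) / 2 + 1 - s - 1) =
      (1 - u) ^ ((n : ℝ) / 2) * (1 - u) ^ (1 - s) * (1 - u)⁻¹ := by
    rw [← e3]; field_simp
  simp only [e0, e4]
  rw [e1, e2, e5]
  field_simp

/-! ### Moments of the normalized coordinates -/

/-- No exception is needed at the origin: both sides vanish at `y = 0`. -/
theorem inv_norm_smul_toLp_apply {ι : Type*} [Fintype ι] (y : ι → ℝ) (i : ι) :
    (‖(WithLp.toLp 2 y : EuclideanSpace ℝ ι)‖⁻¹ • (WithLp.toLp 2 y : EuclideanSpace ℝ ι)) i =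
      y i * (∑ k, y k ^ 2) ^ (-(1 / 2) : ℝ) := by
  have h : 0 ≤ ∑ k, y k ^ 2 := Finset.sum_nonneg fun k _ => sq_nonneg _
  rw [EuclideanSpace.norm_eq, Real.rpow_neg h, ← Real.sqrt_eq_rpow]
  simp [mul_comm]

theorem rpow_neg_half_mul_self {r : ℝ} (hr : 0 ≤ r) :
    r ^ (-(1 / 2) : ℝ) * r ^ (-(1 / 2) : ℝ) = r ^ (-1 : ℝ) := by
  rw [Real.rpow_neg hr, Real.rpow_neg_one, ← Real.sqrt_eq_rpow, ← mul_inv, Real.mul_self_sqrt hr]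

theorem abs_mul_sum_sq_rpow_neg_half_le_one {ι : Type*} [Fintype ι] (y : ι → ℝ) (i : ι) :
    |y i * (∑ k, y k ^ 2) ^ (-(1 / 2) : ℝ)| ≤ 1 := by
  have h : 0 ≤ ∑ k, y k ^ 2 := Finset.sum_nonneg fun k _ => sq_nonneg _
  have hle : y i ^ 2 ≤ ∑ k, y k ^ 2 :=
    Finset.single_le_sum (f := fun k => y k ^ 2) (fun k _ => sq_nonneg _) (Finset.mem_univ i)
  rw [Real.rpow_neg h, ← Real.sqrt_eq_rpow, abs_mul, abs_inv, abs_of_nonneg (Real.sqrt_nonneg _),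
    ← div_eq_mul_inv]
  exact div_le_one_of_le₀ (Real.abs_le_sqrt hle) (Real.sqrt_nonneg _)

theorem memLp_normalized_coord {ι : Type*} [Fintype ι] (μ : Measure (ι → ℝ))
    [IsFiniteMeasure μ] (i : ι) (p : ENNReal) :
    MemLp (fun y : ι → ℝ => y i * (∑ k, y k ^ 2) ^ (-(1 / 2) : ℝ)) p μ :=
  MemLp.of_bound (Measurable.aestronglyMeasurable (by fun_prop)) 1
    (ae_of_all _ fun y => abs_mul_sum_sq_rpow_neg_half_le_one y i)

theorem normalized_coord_mul {ι : Type*} [Fintype ι] (y : ι → ℝ) (i j : ι) :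
    (y i * (∑ k, y k ^ 2) ^ (-(1 / 2) : ℝ)) * (y j * (∑ k, y k ^ 2) ^ (-(1 / 2) : ℝ)) =
      y i * y j * (∑ k, y k ^ 2) ^ (-1 : ℝ) := by
  rw [mul_mul_mul_comm, rpow_neg_half_mul_self (Finset.sum_nonneg fun k _ => sq_nonneg _)]

theorem integrable_mul_sum_sq_rpow_neg_one {ι : Type*} [Fintype ι] (μ : Measure (ι → ℝ))
    [IsFiniteMeasure μ] (i j : ι) :
    Integrable (fun y : ι → ℝ => y i * y j * (∑ k, y k ^ 2) ^ (-1 : ℝ)) μ := by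
  simp_rw [← normalized_coord_mul]
  exact (memLp_normalized_coord μ i 2).integrable_mul (memLp_normalized_coord μ j 2)

section Moments

variable {ι : Type*} [Fintype ι] (m : ι → ℝ) (i : ι)

theorem integral_normalized_coord_pi_gaussianReal :
    ∫ y, y i * (∑ k, y k ^ 2) ^ (-(1 / 2) : ℝ) ∂(Measure.pi fun k => gaussianReal (m k) 1) =
      Real.Gamma ((Fintype.card ι + 1) / 2) / (√2 * Real.Gamma ((Fintype.card ι + 2) / 2)) *
        m i * kummerM (1 / 2) ((Fintype.card ι + 2) / 2) (-((∑ k, m k ^ 2) / 2)) := by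
  set n := Fintype.card ι
  rw [integral_mul_rpow_neg_eq (by fun_prop) (by fun_prop) (ae_sum_sq_pos_pi_gaussianReal m i)
    one_half_pos ((memLp_normalized_coord _ i 1).integrable le_rfl)]
  have h : ∫ t in Set.Ioi (0 : ℝ), t ^ ((1 / 2 : ℝ) - 1) *
      ∫ y, y i * Real.exp (-(t * ∑ k, y k ^ 2)) ∂(Measure.pi fun k => gaussianReal (m k) 1) =
      ∫ t in Set.Ioi (0 : ℝ), m i * (t ^ ((1 / 2 : ℝ) - 1) * ((√(1 + 2 * t))⁻¹ ^ n *
        Real.exp (-(t * (∑ k, m k ^ 2) / (1 + 2 * t))) * (1 + 2 * t)⁻¹)) := by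
    refine setIntegral_congr_fun measurableSet_Ioi fun t ht => ?_
    simp only [integral_eval_mul_exp_neg_mul_sum_sq_pi_gaussianReal m ht i]
    ring
  have hn : (0 : ℝ) ≤ n := n.cast_nonneg
  rw [h, integral_const_mul, setIntegral_rpow_mul_inv_sqrt_pow_mul_exp n _ one_half_pos
    (by linarith), show (n : ℝ) / 2 + 1 - 1 / 2 = (n + 1) / 2 by ring,
    show (n : ℝ) / 2 + 1 = (n + 2) / 2 by ring, Real.rpow_neg zero_le_two, ← Real.sqrt_eq_rpow]
  have := (Real.Gamma_pos_of_pos (one_half_pos (α := ℝ))).ne'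
  field_simp

theorem integral_normalized_coord_mul_of_ne {j : ι} (hij : i ≠ j) (h0 : m i = 0 ∨ m j = 0) :
    ∫ y, y i * y j * (∑ k, y k ^ 2) ^ (-1 : ℝ)
      ∂(Measure.pi fun k => gaussianReal (m k) 1) = 0 := by
  rw [integral_mul_rpow_neg_eq (by fun_prop) (by fun_prop) (ae_sum_sq_pos_pi_gaussianReal m i)
    one_pos (integrable_mul_sum_sq_rpow_neg_one _ i j),
    setIntegral_eq_zero_of_forall_eq_zero, mul_zero]
  intro t ht
  rw [integral_eval_mul_eval_mul_exp_neg_mul_sum_sq_pi_gaussianReal m ht hij]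
  rcases h0 with h0 | h0 <;> simp [h0]

/-- The case `s = 1`. Centring removes the term `(m i / (1 + 2t))²`, whose different power of `1 +
2t` would not fit the common integral; then `Γ(n/2) / Γ(n/2 + 1) = 2 / n` yields the prefactor. -/
theorem integral_normalized_coord_sq (h0 : m i = 0) :
    ∫ y, y i * y i * (∑ k, y k ^ 2) ^ (-1 : ℝ)
      ∂(Measure.pi fun k => gaussianReal (m k) 1) =
      1 / Fintype.card ι * kummerM 1 (Fintype.card ι / 2 + 1) (-((∑ k, m k ^ 2) / 2)) := by
  have hn : (0 : ℝ) < Fintype.card ι := by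
    have : Nonempty ι := ⟨i⟩
    exact_mod_cast Fintype.card_pos
  set n := Fintype.card ι
  rw [integral_mul_rpow_neg_eq (by fun_prop) (by fun_prop) (ae_sum_sq_pos_pi_gaussianReal m i)
    one_pos (integrable_mul_sum_sq_rpow_neg_one _ i i)]
  have h : ∫ t in Set.Ioi (0 : ℝ), t ^ ((1 : ℝ) - 1) *
      ∫ y, y i * y i * Real.exp (-(t * ∑ k, y k ^ 2))
        ∂(Measure.pi fun k => gaussianReal (m k) 1) =
      ∫ t in Set.Ioi (0 : ℝ), t ^ ((1 : ℝ) - 1) * ((√(1 + 2 * t))⁻¹ ^ n *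
        Real.exp (-(t * (∑ k, m k ^ 2) / (1 + 2 * t))) * (1 + 2 * t)⁻¹) := by
    refine setIntegral_congr_fun measurableSet_Ioi fun t ht => ?_
    simp only [integral_eval_sq_mul_exp_neg_mul_sum_sq_pi_gaussianReal m ht i, h0]
    ring
  rw [h, setIntegral_rpow_mul_inv_sqrt_pow_mul_exp n _ one_pos (by linarith),
    add_sub_cancel_right, Real.Gamma_add_one (by positivity), Real.rpow_neg_one]
  have := (Real.Gamma_pos_of_pos (half_pos hn)).ne'
  simp only [Real.Gamma_one]
  field_simp

/-- The normalized vector has unit length almost surely. This supplies the second moment of the one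
coordinate whose mean may be nonzero. -/
theorem sum_integral_normalized_coord_sq [Nonempty ι] :
    ∑ i, ∫ y, y i * y i * (∑ k, y k ^ 2) ^ (-1 : ℝ)
      ∂(Measure.pi fun k => gaussianReal (m k) 1) = 1 := by
  rw [← integral_finsetSum _ fun i _ => integrable_mul_sum_sq_rpow_neg_one _ i i]
  have : ∀ᵐ y ∂(Measure.pi fun k => gaussianReal (m k) 1),
      ∑ i, y i * y i * (∑ k, y k ^ 2) ^ (-1 : ℝ) = 1 := by
    filter_upwards [ae_sum_sq_pos_pi_gaussianReal m (Classical.arbitrary ι)] with y hy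
    rw [← Finset.sum_mul, Real.rpow_neg_one]
    simp_rw [← pow_two]
    exact mul_inv_cancel₀ hy.ne'
  rw [integral_congr_ae this]
  simp

end Moments

/-! ### The covariance matrix -/

theorem covarianceMatrix_normalized_eq {Ω : Type*} [MeasurableSpace Ω] (P : Measure Ω)
    {n : ℕ} (m : Fin n → ℝ) {c : ℝ} (hc : 0 < c) (ξ : Ω → EuclideanSpace ℝ (Fin n))
    (hξ : HasLaw ξ (multivariateGaussian (c • WithLp.toLp 2 m)
      (c ^ 2 • (1 : Matrix (Fin n) (Fin n) ℝ))) P) (i j : Fin n) :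
    covarianceMatrix (fun ω => (‖ξ ω‖)⁻¹ • ξ ω) P i j =
      (∫ y, y i * y j * (∑ k, y k ^ 2) ^ (-1 : ℝ)
        ∂(Measure.pi fun k => gaussianReal (m k) 1)) -
      (∫ y, y i * (∑ k, y k ^ 2) ^ (-(1 / 2) : ℝ)
        ∂(Measure.pi fun k => gaussianReal (m k) 1)) *
      (∫ y, y j * (∑ k, y k ^ 2) ^ (-(1 / 2) : ℝ)
        ∂(Measure.pi fun k => gaussianReal (m k) 1)) := by
  have hm : ∀ i : Fin n, Measurable fun x : EuclideanSpace ℝ (Fin n) => (‖x‖⁻¹ • x) i := by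
    intro i; simp only [PiLp.smul_apply]; fun_prop
  have h1 : covarianceMatrix (fun ω => (‖ξ ω‖)⁻¹ • ξ ω) P i j =
      cov[fun x : EuclideanSpace ℝ (Fin n) => (‖x‖⁻¹ • x) i, fun x => (‖x‖⁻¹ • x) j;
        P.map ξ] :=
    (covariance_map_fun (hm i).aestronglyMeasurable (hm j).aestronglyMeasurable
      hξ.aemeasurable).symm
  -- Scale invariance: the factor `c` cancels against its norm because `c > 0`.
  have h2 : ∀ (i : Fin n) (y : Fin n → ℝ),
      (‖c • (WithLp.toLp 2 y : EuclideanSpace ℝ (Fin n))‖⁻¹ •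
        (c • (WithLp.toLp 2 y : EuclideanSpace ℝ (Fin n)))) i =
        y i * (∑ k, y k ^ 2) ^ (-(1 / 2) : ℝ) := by
    intro i y
    rw [← inv_norm_smul_toLp_apply, norm_smul, Real.norm_of_nonneg hc.le, smul_smul, mul_inv,
      mul_right_comm, inv_mul_cancel₀ hc.ne', one_mul]
  rw [h1, hξ.map_eq, ← map_pi_gaussianReal_eq_multivariateGaussian,
    covariance_map_fun (hm i).aestronglyMeasurable (hm j).aestronglyMeasurable (by fun_prop)]
  simp_rw [h2]
  rw [covariance_eq_sub (memLp_normalized_coord _ i 2) (memLp_normalized_coord _ j 2)]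
  simp only [Pi.mul_apply, normalized_coord_mul]

theorem mainTheorem1 {Ω : Type*} [MeasurableSpace Ω] (P : Measure Ω) [IsProbabilityMeasure P]
    (n : ℕ) (hn : 1 ≤ n) (ν : EuclideanSpace ℝ (Fin n))
    (hν : ν = EuclideanSpace.single (⟨0, hn⟩ : Fin n) ‖ν‖)
    (lam : ℝ) (hlam : 0 < lam) (ξ : Ω → EuclideanSpace ℝ (Fin n))
    (hξ : HasLaw ξ (multivariateGaussian ν (lam ^ 2 • (1 : Matrix (Fin n) (Fin n) ℝ))) P) :
    covarianceMatrix (fun ω => (‖ξ ω‖)⁻¹ • ξ ω) P =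
      Matrix.diagonal fun i : Fin n =>
        if i = ⟨0, hn⟩ then axialVariance n (‖ν‖ / lam)
        else transverseVariance n (‖ν‖ / lam) := by
  set a : Fin n := ⟨0, hn⟩ with ha
  set x : ℝ := ‖ν‖ / lam with hx
  set m : Fin n → ℝ := Pi.single a x with hm
  have hν' : ν = lam • (WithLp.toLp 2 m : EuclideanSpace ℝ (Fin n)) := by
    rw [hν]
    ext k
    by_cases hk : k = a
    · simp [hm, hx, hk]; field_simp
    · simp [hm, hk]
  have hma : m a = x := by simp [hm]
  have hmk : ∀ k, k ≠ a → m k = 0 := fun k hk => by simp [hm, hk]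
  have hsum : ∑ k, m k ^ 2 = x ^ 2 := by
    rw [Finset.sum_eq_single a (fun k _ hk => by simp [hmk k hk]) (by simp), hma]
  have hmean : ∀ k, k ≠ a → ∫ y, y k * (∑ l, y l ^ 2) ^ (-(1 / 2) : ℝ)
      ∂(Measure.pi fun l => gaussianReal (m l) 1) = 0 := fun k hk => by
    rw [integral_normalized_coord_pi_gaussianReal, hmk k hk]; simp
  have hsq : ∀ k, k ≠ a → ∫ y, y k * y k * (∑ l, y l ^ 2) ^ (-1 : ℝ)
      ∂(Measure.pi fun l => gaussianReal (m l) 1) = transverseVariance n x := fun k hk => by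
    rw [integral_normalized_coord_sq m k (hmk k hk), hsum, Fintype.card_fin, transverseVariance]
  rw [hν'] at hξ
  ext i j
  rw [covarianceMatrix_normalized_eq P m hlam ξ hξ i j, Matrix.diagonal_apply]
  by_cases hij : i = j
  · subst hij
    by_cases hi : i = a
    · subst hi
      have : Nonempty (Fin n) := ⟨a⟩
      -- The axial second moment is 1 minus the `n - 1` equal transverse ones.
      have htot := sum_integral_normalized_coord_sq m
      rw [← Finset.add_sum_erase _ _ (Finset.mem_univ a),
        Finset.sum_congr rfl fun k hk => hsq k (Finset.ne_of_mem_erase hk), Finset.sum_const,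
        Finset.card_erase_of_mem (Finset.mem_univ a), Finset.card_univ, Fintype.card_fin,
        nsmul_eq_mul, Nat.cast_sub hn, Nat.cast_one] at htot
      rw [if_pos rfl, if_pos rfl, eq_sub_of_add_eq htot,
        integral_normalized_coord_pi_gaussianReal, hsum, hma, Fintype.card_fin, axialVariance,
        meanResultantLength, transverseVariance, show -(1 / 2) * x ^ 2 = -(x ^ 2 / 2) by ring]
      ring
    · rw [if_pos rfl, if_neg hi, hmean i hi, hsq i hi]
      ring
  -- One of two distinct indices is transverse, so the mixed moment and the product of means both
  -- vanish.
  · have h0 : i ≠ a ∨ j ≠ a := by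
      by_contra! h
      exact hij (h.1.trans h.2.symm)
    rw [if_neg hij, integral_normalized_coord_mul_of_ne m i hij (h0.imp (hmk i) (hmk j))]
    rcases h0 with h | h <;> simp only [hmean _ h] <;> ring
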